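/- Let $q$ be a prime power, $m\ge 1$, $n=q^m-1$, and let $\alpha$ be a generator of $\mathbb{F}_{q^m}^*$. For $i\ge 0$ let $m_i(x)$ denote the minimal polynomial of $\alpha^i$ over $\mathbb{F}_q$. For integers $b\ge 1$ and $2\le\delta\le n$, let $\mathcal{C}_{(q,n,\delta,b)}$ be the BCH code of length $n$ over $\mathbb{F}_q$ with designed distance $\delta$, i.e. the set of all $(c_0,\dots,c_{n-1})\in\mathbb{F}_q^n$ such that the class of $c_0+c_1x+\cdots+c_{n-1}x^{n-1}$ lies in the ideal of $\mathbb{F}_q[x]/\langle x^n-1\rangle$ generated by $\operatorname{lcm}\bigl(m_b(x),m_{b+1}(x),\dots,m_{b+\delta-2}(x)\bigr)$. The dual of a code $\mathcal{C}\subseteq\mathbb{F}_q^n$ is its orthogonal complement $\mathcal{C}^\perp$ with respect to the standard inner product. A BCH code $\mathcal{C}$ is called dually-BCH if $\mathcal{C}^\perp$ is again a BCH code with respect to the same $\alpha$, i.e. $\mathcal{C}^\perp=\mathcal{C}_{(q,n,\delta',b')}$ for some integers $b'\ge1$ and $2\le\delta'\le n$. Let $2\le\delta\le n$. (1) If $q\ge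 3$ and $m\ge 2$, then $\mathcal{C}_{(q,n,\delta,2)}$ is dually-BCH if and only if $$(q-1)q^{m-1}-q^{\lfloor (m-1)/2\rfloor}-1\le\delta\le q^m-2 .$$ (2) If $q=2$ and $m\ge 6$, then $\mathcal{C}_{(2,n,\delta,2)}$ is dually-BCH if and only if $$\delta=2\quad\text{or}\quad 2^{m-1}-2^{\lfloor (m-1)/2\rfloor}-1\le\delta\le n-1 .$$ -/

import Mathlib

open Polynomial

/-- The generator polynomial of the BCH code: the monic least common multiple of the minimal
polynomials over `F` of `β ^ b, β ^ (b + 1), …, β ^ (b + δ - 2)`. -/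
noncomputable def bchGenerator (F : Type*) {K : Type*} [Field F] [Field K] [Algebra F K]
    (β : K) (δ b : ℕ) : F[X] :=
  letI : DecidableEq F := Classical.decEq F
  letI : NormalizedGCDMonoid F[X] := UniqueFactorizationMonoid.toNormalizedGCDMonoid F[X]
  (Finset.Icc b (b + δ - 2)).lcm fun i => minpoly F (β ^ i)

/-- The identification of `F ^ n` with `F[X] ⧸ (X ^ n - 1)`, sending `(c₀, …, cₙ₋₁)` to the class
of `c₀ + c₁ X + ⋯ + cₙ₋₁ X ^ (n - 1)`. -/
noncomputable def wordClass (F : Type*) [Field F] (n : ℕ) :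
    (Fin n → F) →ₗ[F] (F[X] ⧸ Ideal.span {(X ^ n - 1 : F[X])}) :=
  Fintype.linearCombination F fun i : Fin n =>
    Ideal.Quotient.mk (Ideal.span {(X ^ n - 1 : F[X])}) (X ^ (i : ℕ))

/-- The cyclic code of length `n` generated by `g`: the words whose class lies in the ideal
generated by `g` in `F[X] ⧸ (X ^ n - 1)`. -/
noncomputable def cyclicCode {F : Type*} [Field F] (n : ℕ) (g : F[X]) :
    Submodule F (Fin n → F) :=
  ((Ideal.span {Ideal.Quotient.mk (Ideal.span {(X ^ n - 1 : F[X])}) g}).restrictScalars F).comap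
    (wordClass F n)

/-- The BCH code of length `n` over `F` with respect to `β`, with designed distance `δ` and first
exponent `b`. -/
noncomputable def bchCode (F : Type*) {K : Type*} [Field F] [Field K] [Algebra F K]
    (β : K) (n δ b : ℕ) : Submodule F (Fin n → F) :=
  cyclicCode n (bchGenerator F β δ b)

/-- The dual code with respect to the standard inner product. -/
def dualCode {F : Type*} [Field F] {n : ℕ} (C : Submodule F (Fin n → F)) :
    Submodule F (Fin n → F) where
  carrier := {v | ∀ c ∈ C, v ⬝ᵥ c = 0}
  zero_mem' := fun c _ => zero_dotProduct c
  add_mem' := fun hu hv c hc => by rw [add_dotProduct, hu c hc, hv c hc, add_zero]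
  smul_mem' := fun a v hv c hc => by rw [smul_dotProduct, hv c hc, smul_zero]

/-- `C` is a BCH code of length `n` with respect to `β`, with some first exponent `b ≥ 1` and some
designed distance `2 ≤ δ ≤ n`. -/
def IsBCH {F K : Type*} [Field F] [Field K] [Algebra F K] (β : K) {n : ℕ}
    (C : Submodule F (Fin n → F)) : Prop :=
  ∃ δ b : ℕ, 2 ≤ δ ∧ δ ≤ n ∧ 1 ≤ b ∧ C = bchCode F β n δ b

/-- `C` is a dually-BCH code with respect to `β`: both `C` and its dual are BCH codes with respect
to the same root of unity `β`. -/
def IsDuallyBCH {F K : Type*} [Field F] [Field K] [Algebra F K] (β : K) {n : ℕ}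
    (C : Submodule F (Fin n → F)) : Prop :=
  IsBCH β C ∧ IsBCH β (dualCode C)

/-!
A BCH code is the set of words that vanish, as polynomials, at the powers `β ^ i` with `i` in an
interval; as the word has coefficients in `F`, it then vanishes on the union of the `q`-cyclotomic
cosets meeting that interval. Here `β` generates the multiplicative group of `K`, so cyclic codes
are the codes `vanishingCode F n R` of words vanishing on a Frobenius-stable set `R` of units.

Two facts translate duality into combinatorics. The dual of `vanishingCode F n R` is the code of
words vanishing at the units whose inverse is not in `R` (`dualCode_vanishingCode`), and the code
determines `R` (`vanishingCode_injective`). Both rest on a Parseval identity over the units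
(`algebraMap_dotProduct`) and on the words `j ↦ Tr (γ * x ^ j)`, whose polynomial vanishes outside
the Frobenius orbit of `x⁻¹`. Since negating exponents sends intervals to intervals, the code with
exponents `2, …, δ` is dually-BCH exactly when the complement in `ℤ/n` of the cosets meeting
`[2, δ]` is itself the union of the cosets meeting an interval (`isDuallyBCH_bchCode_iff`).

The combinatorial part works with `δ₂ = (q - 1) * q ^ (m - 1) - q ^ ((m - 1) / 2) - 1`.
If `δ₂ ≤ δ < n`, then rotating base-`q` expansions shows that only the coset of `0`, and possibly
that of `-1`, avoid `[2, δ]`, so the interval `[0, 0]` or `[-1, 0]` works. If `δ < δ₂`, the coset of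
`-(1 + q ^ (m / 2))`, whose least element is `δ₂`, avoids `[2, δ]`, so the interval, which contains
`0` and must not run into `2`, contains `-1, …, -(1 + q ^ (m / 2))`; this forces `δ` to be small.
Then the coset of a periodic exponent avoids both `[2, δ]` and the interval: for `q ≥ 3` the
exponent `1 + q + ⋯ + q ^ (m - 1)`, fixed by multiplication by `q` and caught between `2` and
`2 * q ^ (m - 1)`; for `q = 2` and `δ ≥ 3` the exponent `⌊n / 3⌋`, no rotation of which has
two leading ones, whereas the interval lies above `3 * 2 ^ (m - 2)`.
For `q = 2`, `δ = 2` the powers of `2` are exactly the exponents with no rotation in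
`[2 ^ (m - 1) + 1, n]`.
-/

/-! ### Cyclotomic cosets -/

/-- `a` and `b` lie in the same `q`-cyclotomic coset modulo `n`. Exponents are integers rather than
residues so that intervals and inequalities can be used directly. -/
def CycRel (q n a b : ℤ) : Prop := ∃ t : ℕ, a * q ^ t ≡ b [ZMOD n]

namespace CycRel

variable {q n a b c : ℤ}

theorem refl (q n a : ℤ) : CycRel q n a a := ⟨0, by simp⟩

theorem of_modEq (q : ℤ) (h : a ≡ b [ZMOD n]) : CycRel q n a b := ⟨0, by simpa using h⟩

theorem trans (hab : CycRel q n a b) (hbc : CycRel q n b c) : CycRel q n a c := by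
  obtain ⟨s, hs⟩ := hab
  obtain ⟨t, ht⟩ := hbc
  refine ⟨s + t, ?_⟩
  rw [pow_add, ← mul_assoc]
  exact (hs.mul_right _).trans ht

theorem symm {m : ℕ} (hm : 0 < m) (hn : n = q ^ m - 1) (h : CycRel q n a b) :
    CycRel q n b a := by
  obtain ⟨t, ht⟩ := h
  have h1 : q ^ m ≡ 1 [ZMOD n] := by
    rw [hn]
    exact (Int.modEq_iff_dvd.2 ⟨1, by ring⟩).symm
  refine ⟨t * (m - 1), ((ht.mul_right _).symm).trans ?_⟩
  have h2 : a * q ^ t * q ^ (t * (m - 1)) = a * (q ^ m) ^ t := by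
    rw [mul_assoc, ← pow_add, ← pow_mul]
    congr 2
    obtain ⟨k, rfl⟩ := Nat.exists_eq_succ_of_ne_zero hm.ne'
    simp
    ring
  rw [h2]
  simpa using (h1.pow t).mul_left a

theorem neg (h : CycRel q n a b) : CycRel q n (-a) (-b) := by
  obtain ⟨t, ht⟩ := h
  exact ⟨t, by simpa using ht.neg⟩

theorem mul_pow (q n a : ℤ) (t : ℕ) : CycRel q n a (a * q ^ t) := ⟨t, Int.ModEq.refl _⟩

theorem exists_lt {m : ℕ} (hm : 0 < m) (hn : n = q ^ m - 1) (h : CycRel q n a b) :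
    ∃ t < m, a * q ^ t ≡ b [ZMOD n] := by
  obtain ⟨t, ht⟩ := h
  have h1 : q ^ m ≡ 1 [ZMOD n] := by
    rw [hn]
    exact (Int.modEq_iff_dvd.2 ⟨1, by ring⟩).symm
  refine ⟨t % m, Nat.mod_lt _ hm, Int.ModEq.trans ?_ ht⟩
  conv_rhs => rw [← Nat.mod_add_div t m, pow_add, pow_mul]
  simpa using (((h1.pow (t / m)).mul_left (q ^ (t % m))).mul_left a).symm

theorem dvd_iff {m : ℕ} (hm : 0 < m) (hn : n = q ^ m - 1) (h : CycRel q n a b) :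
    n ∣ a ↔ n ∣ b := by
  have key : ∀ {a b}, CycRel q n a b → n ∣ a → n ∣ b := by
    rintro a b ⟨t, ht⟩ ha
    exact ht.dvd_iff.1 (ha.mul_right _)
  exact ⟨key h, key (h.symm hm hn)⟩

end CycRel

/-- Multiplying by a power of `q` moves the leading base-`q` digit to the top position. -/
theorem exists_mul_pow_mem {q y : ℤ} (hy : 1 ≤ y) :
    ∀ {m : ℕ}, y < q ^ m → 0 < q → ∃ j < m, q ^ (m - 1) ≤ y * q ^ j ∧ y * q ^ j < q ^ m
  | 0, h, _ => by simp at h; omega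
  | k + 1, h, hq => by
    by_cases hk : q ^ k ≤ y
    · exact ⟨0, by omega, by simpa using hk, by simpa using h⟩
    · obtain ⟨j, hj, h1, h2⟩ := exists_mul_pow_mem hy (not_le.1 hk) hq
      obtain ⟨i, rfl⟩ : ∃ i, k = i + 1 := ⟨k - 1, by omega⟩
      refine ⟨j + 1, by omega, ?_, ?_⟩
      · simp only [Nat.add_sub_cancel] at h1 ⊢
        nlinarith [pow_succ q i, pow_succ q j]
      · nlinarith [pow_succ q (i + 1), pow_succ q j]

section
variable {q n : ℤ} {m : ℕ}

theorem exists_rep_ge (hq : 2 ≤ q) (hn : n = q ^ m - 1) {y : ℤ} (hy : 1 ≤ y)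
    (hyn : y < n) : ∃ z, CycRel q n y z ∧ q ^ (m - 1) ≤ z ∧ z < n := by
  obtain ⟨j, hj, h1, h2⟩ := exists_mul_pow_mem (q := q) hy (m := m) (by omega) (by omega)
  refine ⟨y * q ^ j, CycRel.mul_pow .., h1, ?_⟩
  rcases Nat.eq_zero_or_pos j with rfl | hj0
  · simpa using hyn
  · have hd : q ∣ q ^ m - y * q ^ j :=
      dvd_sub (dvd_pow_self _ (by omega)) ((dvd_pow_self _ (by omega)).mul_left _)
    have := Int.le_of_dvd (by omega) hd
    omega

/-- The coset of a nonzero residue either is that of `1` or contains a residue at least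
`q ^ (m - 1) + q ^ ((m - 1) / 2)`: a digit `≥ 2` can be rotated to the top, and of two nonzero
digits one is at cyclic distance at most `m / 2` below the other. -/
theorem exists_rep_eq_or_ge (hq : 2 ≤ q) (hm : 2 ≤ m) (hn : n = q ^ m - 1) {y : ℤ} (hy : 1 ≤ y)
    (hyn : y < n) : ∃ z, CycRel q n y z ∧ z < n ∧
      (z = q ^ (m - 1) ∨ q ^ (m - 1) + q ^ ((m - 1) / 2) ≤ z) := by
  obtain ⟨z, hz, hz1, hz2⟩ := exists_rep_ge hq hn hy hyn
  by_cases h : q ^ (m - 1) + q ^ ((m - 1) / 2) ≤ z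
  · exact ⟨z, hz, hz2, Or.inr h⟩
  by_cases h0 : z = q ^ (m - 1)
  · exact ⟨z, hz, hz2, Or.inl h0⟩
  -- `z = q ^ (m - 1) + r` with `r` short: rotate so that the leading digit of `r` is on top
  obtain ⟨r, rfl⟩ : ∃ r, z = q ^ (m - 1) + r := ⟨z - q ^ (m - 1), by ring⟩
  have hr1 : 1 ≤ r := by omega
  have hr2 : r < q ^ ((m - 1) / 2) := by omega
  have hqp : (0 : ℤ) < q := by omega
  obtain ⟨j, hj, h1, h2⟩ := exists_mul_pow_mem hr1 (m := m)
    (hr2.trans_le (pow_le_pow_right₀ (by omega) (by omega))) hqp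
  have hjh : m - 1 < (m - 1) / 2 + j := by
    by_contra hcon
    have h3 : r * q ^ j < q ^ ((m - 1) / 2) * q ^ j := by gcongr
    rw [← pow_add] at h3
    have h4 : q ^ ((m - 1) / 2 + j) ≤ q ^ (m - 1) := pow_le_pow_right₀ (by omega) (by omega)
    omega
  obtain ⟨i, rfl⟩ : ∃ i, j = i + 1 := ⟨j - 1, by omega⟩
  refine ⟨q ^ i + r * q ^ (i + 1), hz.trans ⟨i + 1, ?_⟩, ?_, Or.inr ?_⟩
  · refine Int.modEq_iff_dvd.2 ⟨-q ^ i, ?_⟩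
    have : q ^ m = q ^ (m - 1) * q := by rw [← pow_succ]; congr 1; omega
    rw [hn, this, pow_succ]
    ring
  · have hd : q ^ (i + 1) ∣ q ^ m - r * q ^ (i + 1) :=
      dvd_sub (pow_dvd_pow _ (by omega)) (Dvd.intro_left _ rfl)
    have h5 := Int.le_of_dvd (by omega) hd
    have h6 : q ≤ q ^ i := le_self_pow₀ (by omega) (by omega)
    have h7 : q ^ i * 2 ≤ q ^ i * q := by gcongr
    rw [pow_succ] at h5 h1 h2 ⊢
    omega
  · have h8 : q ^ ((m - 1) / 2) ≤ q ^ i := pow_le_pow_right₀ (by omega) (by omega)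
    omega

/-- The coset of `-(1 + q ^ (m / 2))` consists of the residues `-(q ^ i + q ^ j)` with `i`, `j` at
cyclic distance `m / 2`, which bounds its elements on both sides. -/
theorem mem_coset_neg_one_add_pow (hq : 2 ≤ q) (hm : 2 ≤ m) (hn : n = q ^ m - 1) {x : ℤ}
    (h : CycRel q n (-(1 + q ^ (m / 2))) x) :
    ∃ y, 1 + q ^ (m / 2) ≤ y ∧ y ≤ q ^ (m - 1) + q ^ ((m - 1) / 2) ∧ x ≡ -y [ZMOD n] := by
  obtain ⟨t, ht, hx⟩ := h.exists_lt (by omega) hn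
  have hq1 : (1 : ℤ) ≤ q := by omega
  have hone : ∀ k : ℕ, (1 : ℤ) ≤ q ^ k := fun k => one_le_pow₀ hq1
  have hle : ∀ {i j : ℕ}, i ≤ j → q ^ i ≤ q ^ j := fun h => pow_le_pow_right₀ hq1 h
  by_cases hts : t + m / 2 < m
  · refine ⟨q ^ t + q ^ (t + m / 2), ?_, ?_, hx.symm.trans (congrArg (· % n) ?_)⟩
    · linarith [hone t, hle (show m / 2 ≤ t + m / 2 by omega)]
    · linarith [hle (show t ≤ (m - 1) / 2 by omega), hle (show t + m / 2 ≤ m - 1 by omega)]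
    · ring
  · refine ⟨q ^ t + q ^ (t + m / 2 - m), ?_, ?_, hx.symm.trans (Int.modEq_iff_dvd.2
      ⟨q ^ (t + m / 2 - m), ?_⟩)⟩
    · linarith [hone (t + m / 2 - m), hle (show m / 2 ≤ t by omega)]
    · linarith [hle (show t ≤ m - 1 by omega), hle (show t + m / 2 - m ≤ (m - 1) / 2 by omega)]
    · have : q ^ (t + m / 2 - m) * q ^ m = q ^ t * q ^ (m / 2) := by
        rw [← pow_add, ← pow_add]; congr 1; omega
      rw [hn]
      linear_combination -this

end

/-- The coset of `a` meets the interval `[c, d]`. -/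
def MemCosets (q n c d a : ℤ) : Prop := ∃ i, c ≤ i ∧ i ≤ d ∧ CycRel q n i a

/-- The complement of the union of the cosets meeting `[2, δ]` is the union of the cosets meeting
some nonempty interval of at most `n - 1` integers, taken modulo `n`. -/
def CosetComplIsInterval (q n δ : ℤ) : Prop :=
  ∃ c d : ℤ, c ≤ d ∧ d - c ≤ n - 2 ∧ ∀ a, MemCosets q n c d a ↔ ¬ MemCosets q n 2 δ a

section
variable {q n δ : ℤ} {m : ℕ}

theorem CycRel.add_mul (q n a k : ℤ) : CycRel q n (a + n * k) a :=
  CycRel.of_modEq q (Int.modEq_iff_dvd.2 ⟨-k, by ring⟩)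

theorem memCosets_add_mul {c d a k : ℤ} :
    MemCosets q n (c + n * k) (d + n * k) a ↔ MemCosets q n c d a := by
  constructor
  · rintro ⟨j, h1, h2, h3⟩
    exact ⟨j + n * -k, by linarith, by linarith, (CycRel.add_mul ..).trans h3⟩
  · rintro ⟨j, h1, h2, h3⟩
    exact ⟨j + n * k, by linarith, by linarith, (CycRel.add_mul ..).trans h3⟩

theorem MemCosets.neg {c d a : ℤ} (h : MemCosets q n c d a) :
    MemCosets q n (-d) (-c) (-a) := by
  obtain ⟨i, h1, h2, h3⟩ := h
  exact ⟨-i, by omega, by omega, h3.neg⟩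

/-! ### Thresholds for the complement to be an interval -/

/-- For `δ = n` every coset meets `[2, n]`, since `q` lies in the coset of `1`; the complement is
then empty, while the interval is not. -/
theorem le_of_cosetComplIsInterval (hq : 2 ≤ q) (hm : 2 ≤ m) (hn : n = q ^ m - 1)
    (hδn : δ ≤ n) (h : CosetComplIsInterval q n δ) : δ ≤ n - 1 := by
  by_contra hcon
  obtain rfl : δ = n := by omega
  obtain ⟨c, d, hcd, -, h⟩ := h
  have hqn : q ^ 2 ≤ q ^ m := pow_le_pow_right₀ (by omega) hm
  have hq2 : q + 1 ≤ q ^ 2 := by nlinarith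
  refine (h c).1 ⟨c, le_rfl, hcd, CycRel.refl ..⟩ ?_
  have h1 := Int.emod_nonneg (c - 2) (show δ ≠ 0 by omega)
  have h2 := Int.emod_lt_of_pos (c - 2) (show 0 < δ by omega)
  have h3 : (c - 2) % δ + 2 ≡ c [ZMOD δ] := by
    simpa using (Int.mod_modEq (c - 2) δ).add_right 2
  by_cases h4 : (c - 2) % δ + 2 ≤ δ
  · exact ⟨_, by omega, h4, CycRel.of_modEq q h3⟩
  · have h5 : (1 : ℤ) ≡ c [ZMOD δ] := by
      rw [show (c - 2) % δ + 2 = 1 + δ by omega] at h3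
      exact (by simp : (1 : ℤ) ≡ 1 + δ [ZMOD δ]).trans h3
    refine ⟨q, hq, by omega, CycRel.trans ⟨m - 1, ?_⟩ (CycRel.of_modEq q h5)⟩
    rw [← pow_succ', show m - 1 + 1 = m by omega]
    exact Int.modEq_iff_dvd.2 ⟨-1, by rw [hn]; ring⟩

theorem not_memCosets_zero (hm : 2 ≤ m) (hn : n = q ^ m - 1) (hδn : δ < n) {a : ℤ}
    (ha : n ∣ a) : ¬ MemCosets q n 2 δ a := by
  rintro ⟨j, hj2, hjδ, hj⟩
  have := Int.le_of_dvd (by omega) ((hj.dvd_iff (by omega) hn).2 ha)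
  omega

theorem cosetComplIsInterval_of_le (hq : 2 ≤ q) (hm : 2 ≤ m) (hn : n = q ^ m - 1)
    (hqδ : q ≤ δ)
    (h : (q - 1) * q ^ (m - 1) - q ^ ((m - 1) / 2) - 1 ≤ δ) (hδn : δ ≤ n - 1) :
    CosetComplIsInterval q n δ := by
  have hqn : q ^ 2 ≤ q ^ m := pow_le_pow_right₀ (by omega) hm
  have hq2 : q + 2 ≤ q ^ 2 := by nlinarith
  have hqm : q ^ m = q * q ^ (m - 1) := by rw [← pow_succ']; congr 1; omega
  have hm0 : 0 < m := by omega
  have h1 : ∀ t : ℕ, 1 ≤ q ^ t := fun t => one_le_pow₀ (by omega)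
  have h1q : CycRel q n q 1 := by
    refine ⟨m - 1, ?_⟩
    rw [← hqm]
    exact Int.modEq_iff_dvd.2 ⟨-1, by rw [hn]; ring⟩
  -- a nonzero coset avoiding `[2, δ]` is that of `-1`; the hypothesis `q ≤ δ` excludes that of `1`
  have main : ∀ a, ¬ MemCosets q n 2 δ a → ¬ n ∣ a →
      CycRel q n (-q ^ (m - 1)) a ∧ δ < n - q ^ (m - 1) := by
    intro a ha hna
    have h2 := Int.emod_nonneg (-a) (show n ≠ 0 by omega)
    have h3 := Int.emod_lt_of_pos (-a) (show 0 < n by omega)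
    have h4 : (-a) % n ≠ 0 := fun h => hna ((dvd_neg).1 (Int.dvd_of_emod_eq_zero h))
    obtain ⟨z, hz, hzn, hz'⟩ := exists_rep_eq_or_ge hq hm hn (show 1 ≤ (-a) % n by omega) h3
    have h5 : CycRel q n (-z) a := by
      have := ((CycRel.of_modEq q (Int.mod_modEq (-a) n).symm).trans hz).neg
      rw [neg_neg] at this
      exact this.symm hm0 hn
    have h6 : CycRel q n (n - z) a :=
      (CycRel.of_modEq q (Int.modEq_iff_dvd.2 ⟨-1, by ring⟩)).trans h5
    have h7 : δ < n - z := by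
      by_contra hcon
      by_cases hz1 : 2 ≤ n - z
      · exact ha ⟨_, hz1, by omega, h6⟩
      · rw [show n - z = 1 by omega] at h6
        exact ha ⟨q, hq, hqδ, h1q.trans h6⟩
    rcases hz' with rfl | hz'
    · exact ⟨h5, h7⟩
    · exfalso
      rw [hn, hqm] at h7
      linarith
  by_cases hδ1 : δ < n - q ^ (m - 1)
  · refine ⟨-1, 0, by norm_num, by omega, fun a => ⟨?_, fun ha => ?_⟩⟩
    · rintro ⟨i, hi, hi', hia⟩
      obtain rfl | rfl : i = -1 ∨ i = 0 := by omega
      · rintro ⟨j, hj2, hjδ, hj⟩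
        obtain ⟨t, ht, h2⟩ := (hia.trans (hj.symm hm0 hn)).exists_lt hm0 hn
        have h3 : q ^ t ≤ q ^ (m - 1) := pow_le_pow_right₀ (by omega) (by omega)
        have h4 := Int.le_of_dvd (by linarith [h1 t]) (Int.modEq_iff_dvd.1 h2)
        linarith
      · exact not_memCosets_zero hm hn (by omega) ((hia.dvd_iff hm0 hn).1 (dvd_zero n))
    · by_cases hna : n ∣ a
      · exact ⟨0, by norm_num, le_rfl, CycRel.of_modEq q (Int.modEq_iff_dvd.2 (by simpa using hna))⟩
      · exact ⟨-1, le_rfl, by norm_num, CycRel.trans ⟨m - 1, by simp⟩ (main a ha hna).1⟩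
  · refine ⟨0, 0, le_rfl, by omega, fun a => ⟨?_, fun ha => ?_⟩⟩
    · rintro ⟨i, hi, hi', hia⟩
      obtain rfl : i = 0 := by omega
      exact not_memCosets_zero hm hn (by omega) ((hia.dvd_iff hm0 hn).1 (dvd_zero n))
    · by_cases hna : n ∣ a
      · exact ⟨0, by norm_num, le_rfl, CycRel.of_modEq q (Int.modEq_iff_dvd.2 (by simpa using hna))⟩
      · exact absurd (main a ha hna).2 hδ1

/-- The coset of `0` avoids `[2, δ]`, so the interval can be shifted to contain `n`, and then it ends
before `n + 2`. -/
theorem CosetComplIsInterval.exists_around (hm : 2 ≤ m) (hn : n = q ^ m - 1)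
    (hδ : 2 ≤ δ) (hδn : δ < n) (h : CosetComplIsInterval q n δ) :
    ∃ c d : ℤ, c ≤ n ∧ n ≤ d ∧ d < n + 2 ∧
      ∀ a, MemCosets q n c d a ↔ ¬ MemCosets q n 2 δ a := by
  obtain ⟨c, d, -, -, h⟩ := h
  have hm0 : 0 < m := by omega
  obtain ⟨i, hci, hid, hi⟩ := (h 0).2 (not_memCosets_zero hm hn hδn (dvd_zero n))
  obtain ⟨k, rfl⟩ := (hi.dvd_iff hm0 hn).2 (dvd_zero n)
  have h' : ∀ a, MemCosets q n (c + n * (1 - k)) (d + n * (1 - k)) a ↔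
      ¬ MemCosets q n 2 δ a :=
    fun a => memCosets_add_mul.trans (h a)
  refine ⟨_, _, by linarith, by linarith, ?_, h'⟩
  by_contra hcon
  refine (h' 2).1 ⟨n + 2, by linarith, not_lt.1 hcon, ?_⟩ ⟨2, le_rfl, hδ, CycRel.refl ..⟩
  simpa [add_comm] using CycRel.add_mul q n 2 1

/-- For `δ` below the threshold the coset of `-(1 + q ^ (m / 2))` avoids `[2, δ]`, so the interval
around `n` meets it, necessarily to the left of `n`. -/
theorem left_endpoint_le (hq : 2 ≤ q) (hm : 2 ≤ m) (hn : n = q ^ m - 1)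
    (hδ : 2 ≤ δ) (hδ2 : δ < (q - 1) * q ^ (m - 1) - q ^ ((m - 1) / 2) - 1) {c d : ℤ}
    (hd : d < n + 2) (h : ∀ a, MemCosets q n c d a ↔ ¬ MemCosets q n 2 δ a) :
    c ≤ n - 1 - q ^ (m / 2) := by
  have hqm : q ^ m = q * q ^ (m - 1) := by rw [← pow_succ']; congr 1; omega
  have hm0 : 0 < m := by omega
  have hpos : 0 < q ^ (m / 2) := by positivity
  have h1 : ¬ MemCosets q n 2 δ (-(1 + q ^ (m / 2))) := by
    rintro ⟨j, hj2, hjδ, hj⟩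
    obtain ⟨y, hy1, hy2, hy⟩ := mem_coset_neg_one_add_pow hq hm hn (hj.symm hm0 hn)
    have h2 := Int.le_of_dvd (by linarith) (Int.modEq_iff_dvd.1 hy.symm)
    linarith
  obtain ⟨i, hci, hid, hi⟩ := (h _).2 h1
  obtain ⟨y, hy1, hy2, hy⟩ := mem_coset_neg_one_add_pow hq hm hn (hi.symm hm0 hn)
  by_contra hcon
  have h2 := Int.le_of_dvd (show 0 < i - -y - n by linarith)
    (dvd_sub_self_right.2 (Int.modEq_iff_dvd.1 hy.symm))
  linarith

/-- The interval contains `n - (q ^ s - 1)`, which lies in the coset of `q ^ (m - s) - 1`. -/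
theorem lt_pow_sub_one (hq : 2 ≤ q) (hn : n = q ^ m - 1) {c d : ℤ} (hc : c ≤ n - 1 - q ^ (m / 2))
    (hd : n ≤ d) (h : ∀ a, MemCosets q n c d a ↔ ¬ MemCosets q n 2 δ a) {s : ℕ} (hs : s ≤ m / 2)
    (h2 : 2 ≤ q ^ (m - s) - 1) : δ < q ^ (m - s) - 1 := by
  by_contra hcon
  have h3 : q ^ s ≤ q ^ (m / 2) := pow_le_pow_right₀ (by omega) hs
  have h4 : 0 < q ^ s := by positivity
  refine (h (n + 1 - q ^ s)).1 ⟨_, by linarith, by linarith, CycRel.refl ..⟩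
    ⟨q ^ (m - s) - 1, h2, not_lt.1 hcon, s, congrArg (· % n) ?_⟩
  have : q ^ (m - s) * q ^ s = q ^ m := by rw [← pow_add]; congr 1; omega
  rw [hn]
  linear_combination this

theorem le_of_cosetComplIsInterval_of_three_le (hq : 3 ≤ q) (hm : 2 ≤ m) (hn : n = q ^ m - 1)
    (hδ : 2 ≤ δ) (hδn : δ < n) (h : CosetComplIsInterval q n δ) :
    (q - 1) * q ^ (m - 1) - q ^ ((m - 1) / 2) - 1 ≤ δ := by
  by_contra hcon
  obtain ⟨c, d, hcn, hnd, hd, h⟩ := h.exists_around hm hn hδ hδn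
  have hm0 : 0 < m := by omega
  have hqm : q ^ m = q * q ^ (m - 1) := by rw [← pow_succ']; congr 1; omega
  have hqm1 : q ≤ q ^ (m - 1) := le_self_pow₀ (by omega) (by omega)
  have hδ1 := lt_pow_sub_one (s := 1) (by omega) hn
    (left_endpoint_le (by omega) hm hn hδ (not_le.1 hcon) hd h) hnd h (by omega) (by omega)
  -- all base-`q` digits of `u` are `1`, so its coset modulo `n` is a single residue
  obtain ⟨u, hu⟩ : ∃ u, u = ∑ i ∈ Finset.range m, q ^ i := ⟨_, rfl⟩
  have hun : u * (q - 1) = n := by rw [hu, hn, geom_sum_mul]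
  have hu1 : q ^ (m - 1) ≤ u := by
    rw [hu]
    exact Finset.single_le_sum (f := fun i => q ^ i) (fun i _ => by positivity)
      (Finset.mem_range.2 (by omega))
  have hu2 : u < 2 * q ^ (m - 1) := by nlinarith
  have hun2 : u < n - 1 := by nlinarith
  have hfix : ∀ x, CycRel q n x u → n ∣ u - x := by
    intro x hx
    obtain ⟨t, ht⟩ := hx.symm hm0 hn
    refine Int.modEq_iff_dvd.1 (ht.symm.trans ?_)
    have hq1 : u * q ≡ u [ZMOD n] := Int.modEq_iff_dvd.2 ⟨-1, by rw [← hun]; ring⟩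
    clear ht
    induction t with
    | zero => simp
    | succ t ih =>
      have := ih.mul_right q
      rw [mul_assoc, ← pow_succ] at this
      exact this.trans hq1
  have hu3 : ¬ MemCosets q n 2 δ u := by
    rintro ⟨j, hj2, hjδ, hj⟩
    have := Int.le_of_dvd (by omega) (hfix j hj)
    omega
  obtain ⟨i, hci, hid, hi⟩ := (h u).2 hu3
  have hc : 2 * q ^ (m - 1) < c := by
    by_contra hc
    refine (h (2 * q ^ (m - 1))).1 ⟨_, not_lt.1 hc, ?_, CycRel.refl ..⟩
      ⟨2, le_rfl, hδ, CycRel.mul_pow ..⟩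
    nlinarith
  have := Int.le_of_dvd (by omega) ((dvd_neg.2 (hfix i hi)))
  omega

/-- For `q = 2` and `δ = 2` the interval `[2 ^ (m - 1) + 1, n]` works: a residue that is not a power
of `2` can be rotated to have its top bit set, and is then larger than `2 ^ (m - 1)`. -/
theorem cosetComplIsInterval_two (hm : 2 ≤ m) (hn : n = 2 ^ m - 1) :
    CosetComplIsInterval 2 n 2 := by
  have hm0 : 0 < m := by omega
  have hqm : (2 : ℤ) ^ m = 2 * 2 ^ (m - 1) := by rw [← pow_succ']; congr 1; omega
  have hqm1 : (2 : ℤ) ≤ 2 ^ (m - 1) := le_self_pow₀ (by omega) (by omega)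
  have h21 : CycRel 2 n 2 1 := by
    refine ⟨m - 1, ?_⟩
    rw [← hqm]
    exact Int.modEq_iff_dvd.2 ⟨-1, by rw [hn]; ring⟩
  refine ⟨2 ^ (m - 1) + 1, n, by omega, by omega, fun a => ⟨?_, fun ha => ?_⟩⟩
  · rintro ⟨i, hi, hin, hia⟩ ⟨j, hj, hj', hja⟩
    obtain rfl : j = 2 := by omega
    obtain ⟨t, ht, h1⟩ := ((h21.symm hm0 hn).trans (hja.trans (hia.symm hm0 hn))).exists_lt hm0 hn
    have h2 : (2 : ℤ) ^ t ≤ 2 ^ (m - 1) := pow_le_pow_right₀ (by omega) (by omega)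
    have h3 : (0 : ℤ) < 2 ^ t := by positivity
    have := Int.le_of_dvd (by omega) (Int.modEq_iff_dvd.1 h1)
    omega
  · have h2 := Int.emod_nonneg a (show n ≠ 0 by omega)
    have h3 := Int.emod_lt_of_pos a (show 0 < n by omega)
    by_cases h4 : a % n = 0
    · refine ⟨n, by omega, le_rfl, CycRel.of_modEq 2 (Int.modEq_iff_dvd.2 ?_)⟩
      exact dvd_sub_self_right.2 (Int.dvd_of_emod_eq_zero h4)
    · obtain ⟨z, hz, hz1, hz2⟩ := exists_rep_ge le_rfl hn (show 1 ≤ a % n by omega) h3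
      have h5 := ((CycRel.of_modEq 2 (Int.mod_modEq a n).symm).trans hz).symm hm0 hn
      refine ⟨z, ?_, by omega, h5⟩
      by_contra hcon
      obtain rfl : z = 2 ^ (m - 1) := by omega
      exact ha ⟨2, le_rfl, le_rfl, CycRel.trans (h21.trans ⟨m - 1, by simp⟩) h5⟩

theorem le_of_cosetComplIsInterval_two (hm : 6 ≤ m) (hn : n = 2 ^ m - 1)
    (hδ : 3 ≤ δ) (hδn : δ < n) (h : CosetComplIsInterval 2 n δ) :
    (2 : ℤ) ^ (m - 1) - 2 ^ ((m - 1) / 2) - 1 ≤ δ := by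
  by_contra hcon
  obtain ⟨c, d, hcn, hnd, hd, h⟩ := h.exists_around (by omega) hn (by omega) hδn
  have hm0 : 0 < m := by omega
  have hqm : (2 : ℤ) ^ m = 4 * 2 ^ (m - 2) := by
    rw [show (4 : ℤ) = 2 ^ 2 by norm_num, ← pow_add]; congr 1; omega
  have hqm1 : (2 : ℤ) ^ (m - 1) = 2 * 2 ^ (m - 2) := by rw [← pow_succ']; congr 1; omega
  have hbig : (2 : ℤ) ^ 4 ≤ 2 ^ (m - 2) := pow_le_pow_right₀ (by omega) (by omega)
  have hr : (2 : ℤ) ^ 3 ≤ 2 ^ (m - m / 2) := pow_le_pow_right₀ (by omega) (by omega)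
  have hδ1 : δ < 2 ^ (m - m / 2) - 1 := lt_pow_sub_one (s := m / 2) le_rfl hn
    (left_endpoint_le le_rfl (by omega) hn (by omega) (by linarith) hd h) hnd h le_rfl (by omega)
  -- this is where `m ≥ 6` is needed: it fails for `m = 5` and `δ = 6`
  have hδ2 : 3 * δ < 2 ^ (m - 1) - 1 := by
    rcases Nat.lt_or_ge m 7 with h7 | h7
    · obtain rfl : m = 6 := by omega
      norm_num at hδ1 ⊢
      omega
    · have h8 : (2 : ℤ) ^ (m - m / 2 + 2) ≤ 2 ^ (m - 1) := pow_le_pow_right₀ (by omega) (by omega)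
      rw [pow_add] at h8
      omega
  have hc : 3 * 2 ^ (m - 2) < c := by
    by_contra hc
    refine (h (3 * 2 ^ (m - 2))).1 ⟨_, not_lt.1 hc, by omega, CycRel.refl ..⟩
      ⟨3, by norm_num, hδ, CycRel.mul_pow ..⟩
  have hmod3 : ∀ k : ℕ, (2 : ℤ) ^ k % 3 = 1 ∨ (2 : ℤ) ^ k % 3 = 2 := by
    intro k
    induction k with
    | zero => simp
    | succ k ih => rw [pow_succ]; omega
  -- binary digits of `u` alternate, so every `x` in its coset satisfies `3 * x ≡ 0` (`m` even) or
  -- `3 * x ≡ -2 ^ t` with `t < m` (`m` odd)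
  obtain ⟨u, hu⟩ : ∃ u, n = 3 * u ∨ n = 3 * u + 1 := by
    have := hmod3 m
    exact ⟨n / 3, by omega⟩
  have hrel : ∀ x, CycRel 2 n x u → ∃ t < m, n ∣ x - u * 2 ^ t := by
    intro x hx
    obtain ⟨t, ht, h1⟩ := (hx.symm hm0 hn).exists_lt hm0 hn
    exact ⟨t, ht, Int.modEq_iff_dvd.1 h1⟩
  have hpow : ∀ t < m, (1 : ℤ) ≤ 2 ^ t ∧ (2 : ℤ) ^ t ≤ 2 ^ (m - 1) := fun t ht =>
    ⟨one_le_pow₀ (by norm_num), pow_le_pow_right₀ (by norm_num) (by omega)⟩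
  have hmem : ∀ x, CycRel 2 n x u → n ∣ 3 * x ∧ n = 3 * u ∨
      ∃ t < m, n ∣ 3 * x + 2 ^ t ∧ n = 3 * u + 1 := by
    intro x hx
    obtain ⟨t, ht, k, hk⟩ := hrel x hx
    rcases hu with hu | hu
    · exact Or.inl ⟨⟨2 ^ t + 3 * k, by linear_combination 3 * hk - 2 ^ t * hu⟩, hu⟩
    · exact Or.inr ⟨t, ht, ⟨2 ^ t + 3 * k, by linear_combination 3 * hk - 2 ^ t * hu⟩, hu⟩
  have hu3 : ¬ MemCosets 2 n 2 δ u := by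
    rintro ⟨j, hj2, hjδ, hj⟩
    obtain ⟨h1, -⟩ | ⟨t, ht, h1, -⟩ := hmem j hj
    · have := Int.le_of_dvd (by omega) h1
      omega
    · have := hpow t ht
      have := Int.le_of_dvd (by omega) h1
      omega
  obtain ⟨i, hci, hid, hi⟩ := (h u).2 hu3
  obtain ⟨⟨k, hk⟩, hnu⟩ | ⟨t, ht, ⟨k, hk⟩, hnu⟩ := hmem i hi
  · -- `3 * i` is a multiple of `n` in `(2 * n, 4 * n)`, so `i = n`
    have hk2 : 2 < k := by nlinarith
    have hk4 : k < 4 := by nlinarith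
    obtain rfl : k = 3 := by omega
    have := Int.le_of_dvd (by omega) ((hi.dvd_iff hm0 hn).1 ⟨1, by omega⟩)
    omega
  · -- `3 * i + 2 ^ t = 3 * n` is impossible modulo `3`, and `4 * n` is too large
    have := hpow t ht
    have hk2 : 2 < k := by nlinarith
    have hk4 : k < 4 := by nlinarith
    obtain rfl : k = 3 := by omega
    have := hmod3 t
    omega
end

/-! ### Cyclic codes and their duals in terms of zeros -/

theorem mem_cyclicCode_iff {F : Type*} [Field F] {n : ℕ} {g : F[X]} (hg : g ∣ X ^ n - 1)
    (c : Fin n → F) : c ∈ cyclicCode n g ↔ g ∣ ∑ j, C (c j) * X ^ (j : ℕ) := by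
  have hc : wordClass F n c =
      Ideal.Quotient.mk (Ideal.span {(X ^ n - 1 : F[X])}) (∑ j, C (c j) * X ^ (j : ℕ)) := by
    simp only [wordClass, Fintype.linearCombination_apply, map_sum]
    refine Finset.sum_congr rfl fun j _ => ?_
    rw [← smul_eq_C_mul]
    rfl
  change wordClass F n c ∈ Ideal.span _ ↔ _
  rw [hc, Ideal.mem_span_singleton]
  constructor
  · rintro ⟨a, ha⟩
    obtain ⟨a, rfl⟩ := Ideal.Quotient.mk_surjective a
    rw [← map_mul, Ideal.Quotient.eq, Ideal.mem_span_singleton] at ha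
    exact (dvd_sub_left (dvd_mul_right g a)).1 (hg.trans ha)
  · exact fun h => map_dvd _ h

theorem bchGenerator_dvd_iff {F K : Type*} [Field F] [Field K] [Algebra F K]
    (β : K) (δ b : ℕ) (p : F[X]) :
    bchGenerator F β δ b ∣ p ↔ ∀ i ∈ Finset.Icc b (b + δ - 2), aeval (β ^ i) p = 0 := by
  simp only [bchGenerator, Finset.lcm_dvd_iff, minpoly.dvd_iff]

theorem mem_bchCode_iff {F K : Type*} [Field F] [Field K] [Algebra F K]
    {β : K} {n : ℕ} (hβ : β ^ n = 1) (δ b : ℕ) (c : Fin n → F) :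
    c ∈ bchCode F β n δ b ↔ ∀ i ∈ Finset.Icc b (b + δ - 2),
      ∑ j, algebraMap F K (c j) * (β ^ i) ^ (j : ℕ) = 0 := by
  rw [bchCode, mem_cyclicCode_iff, bchGenerator_dvd_iff]
  · simp
  · rw [bchGenerator_dvd_iff]
    intro i _
    simp [← pow_mul, mul_comm i n, pow_mul β, hβ]

section
variable {F K : Type*} [Field F] [Field K] [Algebra F K] {n : ℕ}

/-- The value at `x` of the polynomial `∑ c j * X ^ j` of a word `c`. -/
def evalWord (c : Fin n → F) (x : Kˣ) : K := ∑ j, algebraMap F K (c j) * (x : K) ^ (j : ℕ)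

/-- The code of words whose polynomial vanishes on the set `R` of units. -/
def vanishingCode (F : Type*) {K : Type*} [Field F] [Field K] [Algebra F K] (n : ℕ)
    (R : Set Kˣ) : Submodule F (Fin n → F) where
  carrier := {c | ∀ x ∈ R, evalWord c x = 0}
  zero_mem' := fun x _ => by simp [evalWord]
  add_mem' := fun ha hb x hx => by
    simpa [evalWord, add_mul, Finset.sum_add_distrib] using congrArg₂ (· + ·) (ha x hx) (hb x hx)
  smul_mem' := fun a c hc x hx => by
    simpa [evalWord, mul_assoc, Finset.mul_sum] using
      congrArg (algebraMap F K a * ·) (hc x hx)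

theorem mem_vanishingCode {R : Set Kˣ} {c : Fin n → F} :
    c ∈ vanishingCode F n R ↔ ∀ x ∈ R, evalWord c x = 0 := Iff.rfl

/-- The word `j ↦ Tr (γ * x ^ j)`. These words span the cyclic code whose only nonzeros are the
conjugates of `x⁻¹`. -/
noncomputable def traceWord (F : Type*) {K : Type*} [Field F] [Field K] [Algebra F K] (n : ℕ)
    (γ : K) (x : Kˣ) : Fin n → F := fun j => Algebra.trace F K (γ * (x : K) ^ (j : ℕ))

theorem dotProduct_traceWord (γ : K) (x : Kˣ) (v : Fin n → F) :
    v ⬝ᵥ traceWord F n γ x = Algebra.trace F K (γ * evalWord v x) := by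
  simp only [dotProduct, traceWord, evalWord, Finset.mul_sum, map_sum]
  refine Finset.sum_congr rfl fun j _ => ?_
  rw [← smul_eq_mul, ← map_smul, Algebra.smul_def]
  congr 1
  ring

theorem geom_sum_units_eq_zero {z : Kˣ} (hz : z ^ n = 1) (hz1 : z ≠ 1) :
    ∑ j : Fin n, (z : K) ^ (j : ℕ) = 0 := by
  rw [Fin.sum_univ_eq_sum_range fun j => (z : K) ^ j]
  have h := geom_sum_mul (z : K) n
  rw [← Units.val_pow_eq_pow_val, hz, Units.val_one, sub_self, mul_eq_zero, sub_eq_zero] at h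
  exact h.resolve_right fun h => hz1 (Units.ext h)

section
variable [Fintype K]

theorem units_pow_eq_one (hn : n = Fintype.card K - 1) (z : Kˣ) : z ^ n = 1 := by
  classical
  rw [hn, ← Fintype.card_units, pow_card_eq_one]

theorem sum_units_pow_mul_inv_pow [DecidableEq K] (hn : n = Fintype.card K - 1) (j k : Fin n) :
    ∑ x : Kˣ, (x : K) ^ (j : ℕ) * ((x⁻¹ : Kˣ) : K) ^ (k : ℕ) = if j = k then -1 else 0 := by
  have h1 : ∀ x : Kˣ, (x : K) ^ (j : ℕ) * ((x⁻¹ : Kˣ) : K) ^ (k : ℕ) =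
      (x : K) ^ ((j : ℕ) + (n - k)) := by
    intro x
    have h2 : (x⁻¹) ^ (k : ℕ) = x ^ (n - k) := by
      rw [inv_pow, inv_eq_iff_mul_eq_one, ← pow_add, Nat.add_sub_cancel' k.2.le,
        units_pow_eq_one hn]
    rw [← Units.val_pow_eq_pow_val x⁻¹, h2, Units.val_pow_eq_pow_val, ← pow_add]
  simp only [h1]
  rw [FiniteField.sum_pow_units, ← hn]
  congr 1
  refine propext ⟨fun h => ?_, fun h => ?_⟩
  · obtain ⟨e, he⟩ := h
    have hj := j.2
    have hk := k.2
    have : e = 1 := by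
      have h3 : e < 2 := by
        by_contra hcon
        have : n * 2 ≤ n * e := Nat.mul_le_mul_left _ (by omega)
        omega
      have h4 : e ≠ 0 := by
        rintro rfl
        omega
      omega
    subst this
    exact Fin.ext (by omega)
  · subst h
    rw [Nat.add_sub_cancel' j.2.le]

/-- Parseval's identity; the sign is the inverse of `n = -1` in `K`. -/
theorem algebraMap_dotProduct [DecidableEq K] (hn : n = Fintype.card K - 1) (v c : Fin n → F) :
    algebraMap F K (v ⬝ᵥ c) = -∑ x : Kˣ, evalWord v x * evalWord c x⁻¹ := by
  have h : ∑ x : Kˣ, evalWord v x * evalWord c x⁻¹ = ∑ j, ∑ k,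
      algebraMap F K (v j) * algebraMap F K (c k) * if j = k then -1 else 0 := by
    simp only [← sum_units_pow_mul_inv_pow hn, evalWord, Finset.sum_mul_sum]
    rw [Finset.sum_comm]
    refine Finset.sum_congr rfl fun j _ => ?_
    rw [Finset.sum_comm]
    refine Finset.sum_congr rfl fun k _ => ?_
    rw [Finset.mul_sum]
    refine Finset.sum_congr rfl fun x _ => ?_
    ring
  rw [h]
  simp [dotProduct]

end

variable [Fintype F]

theorem evalWord_pow_card_pow (c : Fin n → F) (x : Kˣ) (t : ℕ) :
    evalWord c (x ^ Fintype.card F ^ t) = evalWord c x ^ Fintype.card F ^ t := by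
  induction t with
  | zero => simp
  | succ t ih =>
    rw [pow_succ, pow_mul, pow_mul, ← ih]
    generalize x ^ Fintype.card F ^ t = y
    have h : ∀ z : K, z ^ Fintype.card F = FiniteField.frobeniusAlgHom F K z := fun z => rfl
    rw [h, evalWord, evalWord, map_sum]
    refine Finset.sum_congr rfl fun j _ => ?_
    rw [map_mul, AlgHom.commutes, map_pow, ← h, Units.val_pow_eq_pow_val]

variable [Fintype K]

theorem evalWord_traceWord_eq_zero (hn : n = Fintype.card K - 1) {x y : Kˣ} (γ : K)
    (h : ∀ t : ℕ, x ^ Fintype.card F ^ t * y ≠ 1) : evalWord (traceWord F n γ x) y = 0 := by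
  have : ∀ j : Fin n, algebraMap F K (traceWord F n γ x j) * (y : K) ^ (j : ℕ) =
      ∑ t ∈ Finset.range (Module.finrank F K), γ ^ Fintype.card F ^ t *
        ((x ^ Fintype.card F ^ t * y : Kˣ) : K) ^ (j : ℕ) := by
    intro j
    rw [traceWord, FiniteField.algebraMap_trace_eq_sum_pow, Finset.sum_mul]
    refine Finset.sum_congr rfl fun t _ => ?_
    rw [Nat.card_eq_fintype_card]
    push_cast
    ring
  rw [evalWord, Finset.sum_congr rfl fun j _ => this j, Finset.sum_comm]
  refine Finset.sum_eq_zero fun t _ => ?_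
  rw [← Finset.mul_sum, geom_sum_units_eq_zero (units_pow_eq_one hn _) (h t), mul_zero]

theorem pow_card_pow_finrank_mul (x : Kˣ) (s : ℕ) :
    x ^ Fintype.card F ^ (Module.finrank F K * s) = x := by
  induction s with
  | zero => simp
  | succ s ih =>
    rw [Nat.mul_succ, pow_add, pow_mul, ih, ← Module.card_eq_pow_finrank]
    exact Units.ext (by rw [Units.val_pow_eq_pow_val, FiniteField.pow_card])

/-- Frobenius has finite order, so a Frobenius-stable set also contains Frobenius preimages. -/
theorem mem_of_pow_mem {R : Set Kˣ} (hR : ∀ x ∈ R, x ^ Fintype.card F ∈ R) {x : Kˣ} {t : ℕ}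
    (h : x ^ Fintype.card F ^ t ∈ R) : x ∈ R := by
  have hpow : ∀ y ∈ R, ∀ s : ℕ, y ^ Fintype.card F ^ s ∈ R := by
    intro y hy s
    induction s with
    | zero => simpa
    | succ s ih => rw [pow_succ, pow_mul]; exact hR _ ih
  have hm : 0 < Module.finrank F K := Module.finrank_pos
  have h1 := hpow _ h (Module.finrank F K * t - t)
  rwa [← pow_mul, ← pow_add, Nat.add_sub_cancel' (Nat.le_mul_of_pos_left t hm),
    pow_card_pow_finrank_mul] at h1

theorem pow_mem_setOf_inv_notMem {R : Set Kˣ} (hR : ∀ x ∈ R, x ^ Fintype.card F ∈ R) :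
    ∀ x ∈ {x | x⁻¹ ∉ R}, x ^ Fintype.card F ∈ {x | x⁻¹ ∉ R} := fun x hx hx' =>
  hx (mem_of_pow_mem (F := F) hR (t := 1) (by rwa [pow_one, inv_pow]))

theorem traceWord_mem_vanishingCode (hn : n = Fintype.card K - 1) {R : Set Kˣ}
    (hR : ∀ x ∈ R, x ^ Fintype.card F ∈ R) {x : Kˣ} (hx : x⁻¹ ∉ R) (γ : K) :
    traceWord F n γ x ∈ vanishingCode F n R := by
  refine fun y hy => evalWord_traceWord_eq_zero hn γ fun t ht => hx ?_
  refine mem_of_pow_mem (F := F) hR (t := t) ?_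
  rwa [inv_pow, ← eq_inv_of_mul_eq_one_right ht]

theorem dualCode_vanishingCode (hn : n = Fintype.card K - 1) {R : Set Kˣ}
    (hR : ∀ x ∈ R, x ^ Fintype.card F ∈ R) :
    dualCode (vanishingCode F n R) = vanishingCode F n {x | x⁻¹ ∉ R} := by
  ext v
  constructor
  · intro hv x hx
    by_contra hne
    obtain ⟨γ, hγ⟩ := Algebra.trace_surjective F K 1
    have h := hv _ (traceWord_mem_vanishingCode hn hR hx (γ / evalWord v x))
    rw [dotProduct_traceWord, div_mul_cancel₀ _ hne, hγ] at h
    exact one_ne_zero h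
  · intro hv c hc
    classical
    refine (algebraMap F K).injective ?_
    rw [algebraMap_dotProduct hn, map_zero, neg_eq_zero]
    refine Finset.sum_eq_zero fun x _ => ?_
    by_cases hx : x⁻¹ ∈ R
    · rw [hc _ hx, mul_zero]
    · rw [hv x hx, zero_mul]

theorem subset_of_vanishingCode_le (hn : n = Fintype.card K - 1) {R S : Set Kˣ}
    (hR : ∀ x ∈ R, x ^ Fintype.card F ∈ R) (h : vanishingCode F n R ≤ vanishingCode F n S) :
    S ⊆ R := by
  classical
  intro x hxS
  by_contra hxR
  obtain ⟨γ, hγ⟩ := Algebra.trace_surjective F K 1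
  -- the trace word vanishes on the conjugates of `x` because it lies in the code of `S`, and
  -- everywhere else by construction; it would then be zero, but its first entry is `1`
  have h1 : ∀ y : Kˣ, evalWord (traceWord F n γ x⁻¹) y = 0 := by
    intro y
    by_cases hy : ∃ t : ℕ, x⁻¹ ^ Fintype.card F ^ t * y = 1
    · obtain ⟨t, ht⟩ := hy
      rw [inv_pow, inv_mul_eq_one] at ht
      rw [← ht, evalWord_pow_card_pow,
        h (traceWord_mem_vanishingCode hn hR (by rwa [inv_inv]) γ) x hxS]
      exact zero_pow (pow_ne_zero _ Fintype.card_ne_zero)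
    · exact evalWord_traceWord_eq_zero hn γ (not_exists.1 hy)
  have hn0 : 0 < n := by
    rw [hn]
    exact Nat.sub_pos_of_lt Fintype.one_lt_card
  have h2 := algebraMap_dotProduct (K := K) hn (Pi.single ⟨0, hn0⟩ 1) (traceWord F n γ x⁻¹)
  simp [h1, traceWord, hγ] at h2

theorem vanishingCode_injective (hn : n = Fintype.card K - 1) {R S : Set Kˣ}
    (hR : ∀ x ∈ R, x ^ Fintype.card F ∈ R) (hS : ∀ x ∈ S, x ^ Fintype.card F ∈ S) :
    vanishingCode F n R = vanishingCode F n S ↔ R = S :=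
  ⟨fun h => (subset_of_vanishingCode_le hn hS h.ge).antisymm
    (subset_of_vanishingCode_le hn hR h.le), fun h => by rw [h]⟩

end

/-! ### BCH codes and intervals of exponents -/

/-- The iterated `q`-th powers of the elements `a ^ i` for `i` in `[c, d]`. -/
def powerRoots {G : Type*} [Group G] (q : ℕ) (a : G) (c d : ℤ) : Set G :=
  {x | ∃ i : ℤ, c ≤ i ∧ i ≤ d ∧ ∃ t : ℕ, (a ^ i) ^ q ^ t = x}

theorem pow_mem_powerRoots {G : Type*} [Group G] {q : ℕ} {a : G} {c d : ℤ} {x : G}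
    (h : x ∈ powerRoots q a c d) : x ^ q ∈ powerRoots q a c d := by
  obtain ⟨i, hc, hd, t, rfl⟩ := h
  exact ⟨i, hc, hd, t + 1, by rw [pow_succ, pow_mul]⟩

theorem zpow_mem_powerRoots_iff {G : Type*} [Group G] {q : ℕ} {a : G} {c d e : ℤ} :
    a ^ e ∈ powerRoots q a c d ↔ MemCosets q (orderOf a) c d e := by
  refine exists_congr fun i => and_congr_right fun _ => and_congr_right fun _ =>
    exists_congr fun t => ?_
  rw [← zpow_natCast, ← zpow_mul, zpow_eq_zpow_iff_modEq]
  push_cast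
  rfl

theorem bchCode_eq_vanishingCode {F K : Type*} [Field F] [Fintype F] [Field K] [Algebra F K]
    {n : ℕ} {a : Kˣ} (ha : a ^ n = 1) {δ : ℕ} (hδ : 2 ≤ δ) (b : ℕ) :
    bchCode F (a : K) n δ b =
      vanishingCode F n (powerRoots (Fintype.card F) a b (b + δ - 2)) := by
  ext c
  rw [mem_bchCode_iff (by rw [← Units.val_pow_eq_pow_val, ha, Units.val_one]),
    mem_vanishingCode]
  have heval : ∀ i : ℕ, ∑ j, algebraMap F K (c j) * ((a : K) ^ i) ^ (j : ℕ) =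
      evalWord c (a ^ i) := fun i => by simp [evalWord]
  constructor
  · rintro h x ⟨i, hi1, hi2, t, rfl⟩
    obtain ⟨i, rfl⟩ := Int.eq_ofNat_of_zero_le (show 0 ≤ i by omega)
    rw [evalWord_pow_card_pow, zpow_natCast, ← heval, h i (Finset.mem_Icc.2 (by omega))]
    exact zero_pow (pow_ne_zero _ Fintype.card_ne_zero)
  · intro h i hi
    rw [Finset.mem_Icc] at hi
    rw [heval]
    exact h _ ⟨i, by omega, by omega, 0, by simp⟩

theorem isDuallyBCH_bchCode_iff {F K : Type*} [Field F] [Fintype F] [Field K] [Fintype K]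
    [Algebra F K] {n : ℕ} (hn : n = Fintype.card K - 1) {a : Kˣ} (ha : orderOf a = n)
    {δ : ℕ} (hδ : 2 ≤ δ) (hδn : δ ≤ n) :
    IsDuallyBCH (a : K) (bchCode F (a : K) n δ 2) ↔
      CosetComplIsInterval (Fintype.card F) n δ := by
  classical
  have han : a ^ n = 1 := ha ▸ pow_orderOf_eq_one a
  have hsurj : ∀ x : Kˣ, ∃ e : ℤ, a ^ e = x := by
    intro x
    have h := Subgroup.eq_top_of_card_eq (Subgroup.zpowers a)
      (by rw [Nat.card_zpowers, ha, Nat.card_eq_fintype_card, Fintype.card_units, hn])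
    exact Subgroup.mem_zpowers_iff.1 (h ▸ Subgroup.mem_top x)
  have hdual : ∀ δ' b' : ℕ, 2 ≤ δ' →
      (dualCode (bchCode F (a : K) n δ 2) = bchCode F (a : K) n δ' b' ↔
        ∀ e : ℤ, ¬ MemCosets (Fintype.card F) n 2 δ (-e) ↔
          MemCosets (Fintype.card F) n b' (b' + δ' - 2) e) := by
    intro δ' b' hδ'
    rw [bchCode_eq_vanishingCode han hδ, bchCode_eq_vanishingCode han hδ',
      dualCode_vanishingCode hn fun _ => pow_mem_powerRoots,
      vanishingCode_injective hn (pow_mem_setOf_inv_notMem fun _ => pow_mem_powerRoots)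
        fun _ => pow_mem_powerRoots, Set.ext_iff]
    have hmem : ∀ e : ℤ, (a ^ e ∈ {x | x⁻¹ ∉ powerRoots (Fintype.card F) a 2 (2 + δ - 2)} ↔
        a ^ e ∈ powerRoots (Fintype.card F) a b' (b' + δ' - 2)) ↔
        (¬ MemCosets (Fintype.card F) n 2 δ (-e) ↔
          MemCosets (Fintype.card F) n b' (b' + δ' - 2) e) := by
      intro e
      rw [Set.mem_ofPred_eq, ← zpow_neg, zpow_mem_powerRoots_iff, zpow_mem_powerRoots_iff, ha,
        add_sub_cancel_left]
    refine ⟨fun h e => (hmem e).1 (h _), fun h x => ?_⟩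
    obtain ⟨e, rfl⟩ := hsurj x
    exact (hmem e).2 (h e)
  constructor
  · rintro ⟨-, δ', b', hδ', hδn', hb', h⟩
    rw [hdual δ' b' hδ'] at h
    refine ⟨-(b' + δ' - 2), -b', by omega, by omega, fun e => ?_⟩
    have := h (-e)
    rw [neg_neg] at this
    rw [this]
    exact ⟨fun h => by simpa using h.neg, fun h => by simpa using h.neg⟩
  · rintro ⟨c, d, hcd, hdc, h⟩
    -- negate the interval and shift it by a multiple of `n` to make its first exponent positive
    have hb : 1 ≤ -d + n * (|d| + 1) := by
      have h1 : (1 : ℤ) ≤ n := by omega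
      have h2 := le_abs_self d
      nlinarith [abs_nonneg d]
    obtain ⟨b', hb'⟩ := Int.eq_ofNat_of_zero_le (show 0 ≤ -d + n * (|d| + 1) by omega)
    obtain ⟨δ', hδ'⟩ := Int.eq_ofNat_of_zero_le (show 0 ≤ d - c + 2 by omega)
    refine ⟨⟨δ, 2, hδ, hδn, one_le_two, rfl⟩, δ', b', by omega, by omega, by omega, ?_⟩
    rw [hdual δ' b' (by omega)]
    intro e
    rw [← h (-e), show (b' : ℤ) + δ' - 2 = -c + n * (|d| + 1) by linarith, ← hb',
      memCosets_add_mul]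
    exact ⟨fun h => by simpa using h.neg, fun h => by simpa using h.neg⟩

theorem theorem12 {F K : Type*} [Field F] [Fintype F] [Field K] [Algebra F K]
    (q m n δ : ℕ) (hq : Fintype.card F = q) (hm : Module.finrank F K = m)
    (hn : n = q ^ m - 1) (α : K) (hα : IsPrimitiveRoot α n) (hδ : 2 ≤ δ) (hδn : δ ≤ n) :
    (3 ≤ q → 2 ≤ m →
      (IsDuallyBCH α (bchCode F α n δ 2) ↔
        ((q : ℤ) - 1) * (q : ℤ) ^ (m - 1) - (q : ℤ) ^ ((m - 1) / 2) - 1 ≤ (δ : ℤ) ∧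
          (δ : ℤ) ≤ (q : ℤ) ^ m - 2)) ∧
    (q = 2 → 6 ≤ m →
      (IsDuallyBCH α (bchCode F α n δ 2) ↔
        δ = 2 ∨
          ((2 : ℤ) ^ (m - 1) - (2 : ℤ) ^ ((m - 1) / 2) - 1 ≤ (δ : ℤ) ∧
            (δ : ℤ) ≤ (n : ℤ) - 1))) := by
  have hn' : (n : ℤ) = (q : ℤ) ^ m - 1 := by
    have : 0 < q ^ m := by omega
    rw [hn]
    push_cast [Nat.cast_sub this]
    rfl
  have key : 2 ≤ m → (IsDuallyBCH α (bchCode F α n δ 2) ↔ CosetComplIsInterval q n δ) := by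
    intro hm2
    have : Module.Finite F K := Module.finite_of_finrank_pos (by omega)
    have : Finite K := Module.finite_of_finite F
    let _ : Fintype K := Fintype.ofFinite K
    have hcard : n = Fintype.card K - 1 := by
      rw [Module.card_eq_pow_finrank (K := F), hq, hm, hn]
    have hunit : IsUnit α := hα.isUnit (by omega)
    have ha : orderOf hunit.unit = n := by
      rw [← orderOf_units, IsUnit.unit_spec, hα.eq_orderOf]
    have := isDuallyBCH_bchCode_iff (F := F) hcard ha hδ hδn
    rwa [IsUnit.unit_spec, hq] at this
  refine ⟨fun hq3 hm2 => ?_, fun hq2 hm6 => ?_⟩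
  · rw [key hm2]
    have hq3' : (3 : ℤ) ≤ q := by exact_mod_cast hq3
    constructor
    · intro h
      have h1 := le_of_cosetComplIsInterval (by omega) hm2 hn' (by omega) h
      exact ⟨le_of_cosetComplIsInterval_of_three_le hq3' hm2 hn' (by omega) (by omega) h,
        by omega⟩
    · rintro ⟨h1, h2⟩
      refine cosetComplIsInterval_of_le (by omega) hm2 hn' ?_ h1 (by omega)
      -- the lower bound on `δ` gives `q ≤ δ`
      have h3 : (q : ℤ) ^ ((m - 1) / 2) ≤ (q : ℤ) ^ (m - 2) :=
        pow_le_pow_right₀ (by omega) (by omega)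
      have h4 : (q : ℤ) ^ (m - 1) = q * (q : ℤ) ^ (m - 2) := by
        rw [← pow_succ']; congr 1; omega
      have h5 : (1 : ℤ) ≤ (q : ℤ) ^ (m - 2) := one_le_pow₀ (by omega)
      rw [h4] at h1
      have h6 : 0 ≤ ((q : ℤ) ^ (m - 2) - 1) * ((q - 1) * q - 1) :=
        mul_nonneg (by omega) (by nlinarith)
      nlinarith
  · subst hq2
    rw [key (by omega)]
    push_cast at hn' ⊢
    constructor
    · intro h
      by_cases h2 : δ = 2
      · exact Or.inl h2
      · have h1 := le_of_cosetComplIsInterval le_rfl (by omega) hn' (by omega) h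
        exact Or.inr ⟨le_of_cosetComplIsInterval_two hm6 hn' (by omega) (by omega) h, h1⟩
    · rintro (rfl | ⟨h1, h2⟩)
      · exact cosetComplIsInterval_two (by omega) hn'
      · exact cosetComplIsInterval_of_le le_rfl (by omega) hn' (by omega)
          (by simpa using h1) h2
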